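/- Let $\mathcal A=\{a,b\}$ with the discrete topology, let $\mathcal A^{\mathbb Z}$ carry the product topology, and for $m\in\mathbb Z$ let $\tau^m$ be the translation $(\tau^m\xi)(n)=\xi(n-m)$. Let $S$ be the Fibonacci substitution, i.e. the homomorphism of the monoid of finite words with $S(a)=ab$, $S(b)=a$; it acts on two-sided infinite words by $S(\xi)=\ldots S(\xi(-2))S(\xi(-1))\cdot S(\xi(0))S(\xi(1))\ldots$, where the dot is placed directly before position $0$. Let $\Xi\subseteq\mathcal A^{\mathbb Z}$ be the Fibonacci subshift, i.e. the set of all $\xi$ each of whose finite subwords is a subword of $S^n(x)$ for some $n\in\mathbb N$ and $x\in\{a,b\}$. For $k\in\mathbb N$ let $\eta^a_k:=S^k(a^\infty)$ and $\eta^b_k:=S^k(b^\infty)$, where $x^\infty$ is the constant two-sided word $\ldots xx\cdot xx\ldots$; these are periodic. Let $K\subseteq\mathbb Z\setminus\{0\}$ be finite, and let $v:\mathcal A^{\mathbb Z}\to\mathbb C$ and $t_k:\mathcal A^{\mathbb Z}\to\mathbb C$ ($k\in K$) be continuous functions such that $v$ is real valued, $-K=K$, and $t_{-k}(\xi)=\overline{t_k(\tau^{-k}\xi)}$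 for all $k\in K$ and $\xi\in\mathcal A^{\mathbb Z}$. For $\xi\in\mathcal A^{\mathbb Z}$ let $H_\xi$ be the bounded self-adjoint operator on $\ell^2(\mathbb Z)$ (complex sequences) given by $$(H_\xi\psi)(n)=\sum_{k\in K}t_k(\tau^{-n}\xi)\,\psi(n-k)+v(\tau^{-n}\xi)\,\psi(n),\qquad \psi\in\ell^2(\mathbb Z),\ n\in\mathbb Z,$$ and let $\sigma(H_\xi)\subseteq\mathbb R$ be its spectrum. Then, for every $\xi\in\Xi$, $$\sigma(H_\xi)=\lim_{k\to\infty}\sigma(H_{\eta^a_k})=\lim_{k\to\infty}\sigma(H_{\eta^b_k}),$$ where the limits are taken in the Hausdorff metric on the non-empty compact subsets of $\mathbb R$. -/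

import Mathlib

open Filter Topology
open scoped ENNReal ComplexConjugate

/-! ### Words, substitutions and subshifts over an alphabet `A`

Finite words are the elements of the free monoid `FreeMonoid A`; two-sided infinite words
(configurations) are the maps `ℤ → A`, with the product topology. -/

section Words

variable {A : Type*}

/-- The translation `τ^m` of configurations, `(τ^m ξ)(n) = ξ(n - m)`. -/
def shiftConfig (m : ℤ) (ξ : ℤ → A) : ℤ → A := fun n => ξ (n - m)

/-- The subword `ξ(l) ξ(l+1) … ξ(l+n-1)` of length `n` of a configuration `ξ`. -/
def wordAt (ξ : ℤ → A) (l : ℤ) (n : ℕ) : FreeMonoid A :=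
  FreeMonoid.ofList ((List.range n).map fun i : ℕ => ξ (l + (i : ℤ)))

/-- A substitution: a homomorphism from the monoid of finite words to itself. -/
abbrev Substitution (A : Type*) := FreeMonoid A →* FreeMonoid A

/-- The dictionary of a substitution `S`: all subwords of the words `S^n(x)`, with `n ∈ ℕ` and
`x` a letter. -/
def Substitution.dictionary (S : Substitution A) : Set (FreeMonoid A) :=
  {w | ∃ (n : ℕ) (x : A) (u v : FreeMonoid A), S^[n] (FreeMonoid.of x) = u * w * v}

/-- The subshift of a substitution `S`: the configurations all of whose finite subwords lie in the
dictionary of `S`. -/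
def Substitution.subshift [TopologicalSpace A] [DiscreteTopology A] (S : Substitution A) :
    SymbolicDynamics.FullShift.Subshift A ℤ where
  carrier := {ξ | ∀ (l : ℤ) (n : ℕ), wordAt ξ l n ∈ S.dictionary}
  isClosed := by
    have key : ∀ (l : ℤ) (n : ℕ), IsClosed {ξ : ℤ → A | wordAt ξ l n ∈ S.dictionary} := by
      intro l n
      let r : (ℤ → A) → (Fin n → A) := fun ξ i => ξ (l + (i : ℕ))
      have hr : Continuous r := by fun_prop
      let W : Set (Fin n → A) := {w | FreeMonoid.ofList (List.ofFn w) ∈ S.dictionary}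
      have hW : {ξ : ℤ → A | wordAt ξ l n ∈ S.dictionary} = r ⁻¹' W := by
        ext ξ
        have : (List.range n).map (fun i : ℕ => ξ (l + i)) = List.ofFn (r ξ) := by
          apply List.ext_getElem <;> simp [r]
        simp [W, wordAt, this]
      rw [hW]
      exact (isClosed_discrete W).preimage hr
    simp only [Set.ofPred_forall]
    exact isClosed_iInter fun l => isClosed_iInter fun n => key l n
  mapsTo := by
    intro g ξ hξ l n
    have : wordAt (SymbolicDynamics.FullShift.shift g ξ) l n = wordAt ξ (g + l) n := by
      simp [wordAt, add_assoc]
    rw [this]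
    exact hξ _ _

/-- The action of a substitution `S` (with `S(x)` non-empty for each letter `x`) on configurations:
`S(ξ) = … S(ξ(-2)) S(ξ(-1)) · S(ξ(0)) S(ξ(1)) …`, where the dot is to the left of position `0`.
For `m ≥ 0`, the letter at position `m` is read off `S(ξ(0) … ξ(m))`, a word of at least `m + 1`
letters which starts at position `0`; for `m < 0`, it is read off `S(ξ(m) … ξ(-1))`, a word of at
least `-m` letters which ends at position `-1`. The fallback value `ξ 0` is then never used. -/
def Substitution.onConfig (S : Substitution A) (ξ : ℤ → A) : ℤ → A := fun m =>
  if 0 ≤ m then (S (wordAt ξ 0 (m.toNat + 1))).toList.getD m.toNat (ξ 0)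
  else (S (wordAt ξ m (-m).toNat)).toList.reverse.getD (-m - 1).toNat (ξ 0)

end Words

/-! ### The Fibonacci substitution -/

/-- The two-letter alphabet `{a, b}`. -/
inductive FibLetter
  | a
  | b
  deriving DecidableEq

instance : Fintype FibLetter where
  elems := {FibLetter.a, FibLetter.b}
  complete := fun x => by cases x <;> simp

/-- The alphabet carries the discrete topology. -/
instance : TopologicalSpace FibLetter := ⊥

instance : DiscreteTopology FibLetter := ⟨rfl⟩

/-- The Fibonacci substitution `a ↦ ab`, `b ↦ a`. -/
def fibSubst : Substitution FibLetter :=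
  FreeMonoid.lift fun
    | FibLetter.a => FreeMonoid.of FibLetter.a * FreeMonoid.of FibLetter.b
    | FibLetter.b => FreeMonoid.of FibLetter.a

/-- The periodic configuration `S^k(x^∞)`, where `S` is the Fibonacci substitution and `x^∞` the
constant configuration `… x x · x x …`. -/
def fibPeriodic (x : FibLetter) (k : ℕ) : ℤ → FibLetter :=
  fibSubst.onConfig^[k] fun _ => x

/-! ### Finite-range Hamiltonians on `ℓ²(ℤ)` -/

noncomputable section Hamiltonians

/-- The Hilbert space `ℓ²(ℤ)` of complex square-summable two-sided sequences. -/
abbrev EllTwo : Type := lp (fun _ : ℤ => ℂ) 2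

theorem memℓp_translate (m : ℤ) (ψ : EllTwo) : Memℓp (fun n : ℤ => ψ (n - m)) 2 := by
  have h := (lp.memℓp ψ).summable (by norm_num)
  exact memℓp_gen ((Equiv.subRight m).summable_iff.mpr h)

/-- The unitary translation `(U_m ψ)(n) = ψ(n - m)` on `ℓ²(ℤ)`. -/
def translationOp (m : ℤ) : EllTwo →L[ℂ] EllTwo :=
  LinearIsometry.toContinuousLinearMap
    { toFun := fun ψ => ⟨fun n => ψ (n - m), memℓp_translate m ψ⟩
      map_add' := fun _ _ => rfl
      map_smul' := fun _ _ => rfl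
      norm_map' := fun ψ => by
        change ‖(⟨fun n => ψ (n - m), memℓp_translate m ψ⟩ : EllTwo)‖ = ‖ψ‖
        rw [lp.norm_eq_tsum_rpow (by norm_num), lp.norm_eq_tsum_rpow (by norm_num)]
        congr 1
        exact (Equiv.subRight m).tsum_eq (fun n => ‖ψ n‖ ^ (2 : ℝ≥0∞).toReal) }

@[simp] theorem translationOp_apply (m : ℤ) (ψ : EllTwo) (n : ℤ) :
    translationOp m ψ n = ψ (n - m) := rfl

variable {A : Type*} [TopologicalSpace A] [Finite A]

/-- For a continuous function `g` on the configuration space, the operator of multiplication by the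
bounded sequence `n ↦ g(τ^{-n} ξ)` on `ℓ²(ℤ)`. -/
def multOp (g : C(ℤ → A, ℂ)) (ξ : ℤ → A) : EllTwo →L[ℂ] EllTwo :=
  lp.mapCLM 2 (fun n : ℤ => g (shiftConfig (-n) ξ) • ContinuousLinearMap.id ℂ ℂ)
    (norm_nonneg g) fun n => by
      rw [norm_smul, ContinuousLinearMap.norm_id, mul_one]
      exact g.norm_coe_le_norm _

@[simp] theorem multOp_apply (g : C(ℤ → A, ℂ)) (ξ : ℤ → A) (ψ : EllTwo) (n : ℤ) :
    multOp g ξ ψ n = g (shiftConfig (-n) ξ) * ψ n := rfl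

/-- The data of a finite-range Hamiltonian over the full shift `A^ℤ`: a finite set `K ⊆ ℤ ∖ {0}`,
continuous hopping functions `t_k : A^ℤ → ℂ` (only those with `k ∈ K` matter) and a continuous
potential `v : A^ℤ → ℂ`. -/
structure FiniteRangeHamiltonian (A : Type*) [TopologicalSpace A] where
  K : Finset ℤ
  zero_notMem : (0 : ℤ) ∉ K
  t : ℤ → C(ℤ → A, ℂ)
  v : C(ℤ → A, ℂ)

namespace FiniteRangeHamiltonian

/-- The bounded operator `H_ξ = ∑_{k ∈ K} t̂_{ξ,k} U_k + v̂_ξ` on `ℓ²(ℤ)`, where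
`t̂_{ξ,k}(n) = t_k(τ^{-n} ξ)` and `v̂_ξ(n) = v(τ^{-n} ξ)`. -/
def op (H : FiniteRangeHamiltonian A) (ξ : ℤ → A) : EllTwo →L[ℂ] EllTwo :=
  ∑ k ∈ H.K, multOp (H.t k) ξ * translationOp k + multOp H.v ξ

theorem op_apply (H : FiniteRangeHamiltonian A) (ξ : ℤ → A) (ψ : EllTwo) (n : ℤ) :
    H.op ξ ψ n =
      ∑ k ∈ H.K, H.t k (shiftConfig (-n) ξ) * ψ (n - k) + H.v (shiftConfig (-n) ξ) * ψ n := by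
  simp only [op, add_apply, sum_apply, lp.coeFn_add, Pi.add_apply, multOp_apply]
  rw [lp.coeFn_sum, Finset.sum_apply]
  rfl

/-- The conditions on the coefficients which make all `H_ξ` self-adjoint: `v` is real valued, `K`
is invariant under `k ↦ -k`, and `t_{-k}(ξ)` is the complex conjugate of `t_k(τ^{-k} ξ)`. -/
structure IsSymmetric {A : Type*} [TopologicalSpace A] (H : FiniteRangeHamiltonian A) : Prop where
  v_real : ∀ ξ, (H.v ξ).im = 0
  neg_mem : ∀ k ∈ H.K, -k ∈ H.K
  t_neg : ∀ k ∈ H.K, ∀ ξ, H.t (-k) ξ = conj (H.t k (shiftConfig (-k) ξ))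

theorem IsSymmetric.isSelfAdjoint {H : FiniteRangeHamiltonian A} (hH : H.IsSymmetric)
    (ξ : ℤ → A) : IsSelfAdjoint (H.op ξ) := by
  have hv : star (multOp H.v ξ) = multOp H.v ξ := by
    rw [ContinuousLinearMap.star_eq_adjoint]
    symm
    rw [ContinuousLinearMap.eq_adjoint_iff]
    intro φ ψ
    simp only [lp.inner_eq_tsum, multOp_apply]
    refine tsum_congr fun n => ?_
    have : conj (H.v (shiftConfig (-n) ξ)) = H.v (shiftConfig (-n) ξ) :=
      Complex.conj_eq_iff_im.mpr (hH.v_real _)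
    simp only [RCLike.inner_apply, map_mul, this]
    ring
  have ht : ∀ k ∈ H.K, star (multOp (H.t k) ξ * translationOp k) =
      multOp (H.t (-k)) ξ * translationOp (-k) := by
    intro k hk
    rw [ContinuousLinearMap.star_eq_adjoint]
    symm
    rw [ContinuousLinearMap.eq_adjoint_iff]
    intro φ ψ
    simp only [lp.inner_eq_tsum, mul_apply_eq_comp, multOp_apply,
      translationOp_apply]
    rw [← (Equiv.subRight k).tsum_eq]
    refine tsum_congr fun n => ?_
    have e : shiftConfig (-k) (shiftConfig (-(n - k)) ξ) = shiftConfig (-n) ξ := by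
      funext j
      simp only [shiftConfig]
      congr 1
      ring
    simp only [Equiv.subRight_apply, RCLike.inner_apply, map_mul, hH.t_neg k hk, e,
      Complex.conj_conj, sub_neg_eq_add, sub_add_cancel]
    ring
  unfold IsSelfAdjoint op
  rw [star_add, star_sum, hv, Finset.sum_congr rfl ht]
  congr 1
  refine Finset.sum_bij' (fun k _ => -k) (fun k _ => -k) hH.neg_mem hH.neg_mem ?_ ?_ ?_ <;> simp

instance : Nontrivial EllTwo :=
  ⟨lp.single 2 (0 : ℤ) (1 : ℂ), 0, fun h => by
    have := congrArg (fun ψ : EllTwo => ψ 0) h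
    simp at this⟩

/-- The spectrum `σ(H_ξ)` of the self-adjoint operator `H_ξ`, as a non-empty compact subset of `ℝ`;
the type `NonemptyCompacts ℝ` carries the Hausdorff metric. (As `H_ξ` is self-adjoint, its spectrum
in `ℂ` is contained in `ℝ`; see `image_coe_spec`.) -/
def spec (H : FiniteRangeHamiltonian A) (hH : H.IsSymmetric) (ξ : ℤ → A) :
    TopologicalSpace.NonemptyCompacts ℝ where
  carrier := {x : ℝ | (x : ℂ) ∈ spectrum ℂ (H.op ξ)}
  isCompact' :=
    Complex.isometry_ofReal.isClosedEmbedding.isCompact_preimage (spectrum.isCompact (H.op ξ))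
  nonempty' := by
    have : Nontrivial (EllTwo →L[ℂ] EllTwo) :=
      ⟨1, 0, fun h => by
        obtain ⟨ψ, hψ⟩ := exists_ne (0 : EllTwo)
        exact hψ (congrArg (fun T : EllTwo →L[ℂ] EllTwo => T ψ) h)⟩
    obtain ⟨z, hz⟩ := spectrum.nonempty (H.op ξ)
    refine ⟨z.re, ?_⟩
    have h := (hH.isSelfAdjoint ξ).mem_spectrum_eq_re hz
    change (z.re : ℂ) ∈ spectrum ℂ (H.op ξ)
    rwa [← h]

theorem image_coe_spec (H : FiniteRangeHamiltonian A) (hH : H.IsSymmetric) (ξ : ℤ → A) :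
    Complex.ofReal '' (H.spec hH ξ : Set ℝ) = spectrum ℂ (H.op ξ) := by
  ext z
  constructor
  · rintro ⟨x, hx, rfl⟩
    exact hx
  · intro hz
    have h := (hH.isSelfAdjoint ξ).mem_spectrum_eq_re hz
    refine ⟨z.re, ?_, h.symm⟩
    change (z.re : ℂ) ∈ spectrum ℂ (H.op ξ)
    rwa [← h]

end FiniteRangeHamiltonian

end Hamiltonians

/-!
The spectrum of `H_ξ` depends, in the Hausdorff metric, only on the words of a large length `m`
which occur in `ξ`, with an error that tends to zero as `m` grows, uniformly in `ξ`. The theorem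
follows, because for each `m` the periodic configurations `S^k(a^∞)` have, for large `k`, exactly
the same words of length `m` as any element of the Fibonacci subshift.

*Spectra* (`exists_spec_near`). For self-adjoint `T` and real `x`, the distance of `x` to the
spectrum is the best constant `c` in `c ‖ψ‖ ≤ ‖(T - x) ψ‖`, so that one has to transfer such lower
bounds from `H_ξ` to `H_η` when the words of length `m` of `η` occur in `ξ`
(`exists_transfer_lower_bound`). Let `φ` be the indicator function of an interval of length `L`,
and let `φ_j` be its translates. On the support of `φ_j ψ`, the configuration `η` looks like a
translate of `ξ`, so that `H_η (φ_j ψ)` is close to what a unitary conjugate of `H_ξ` makes of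
`φ_j ψ`; hence the lower bound of `H_ξ` holds for `H_η` on `φ_j ψ`. The `ℓ²`-norm in `j` of
`‖φ_j ψ‖` is `√L ‖ψ‖` (`hasSum_norm_cutoff_sq`), whereas that of the commutators of `H_η` with `φ_j`
is bounded independently of `L` (`op_cutoff`, `sqNorm_translateDiff_boxFunction_le`), because
translating an interval changes it only at its ends. Taking `ℓ²`-norms in `j` and dividing by `√L`
gives the bound for `ψ`.

*Words* (`eventually_words_fibPeriodic_a`). The configuration `S^k(a^∞)` is the periodic repetition
of `S^k(a)`, so that its words of length at most `k` occur in `S^k(aa)`, and they are in the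
dictionary because `aa` is. Conversely, a word of the dictionary occurs in `S^k(a)` for all large
`k`. Therefore it occurs in all blocks `S^(n+1)(a)`, `S^(n+1)(b)` of which long words of the
dictionary are composed, hence in every element of the subshift. The case of `S^k(b^∞)` reduces to
this one, as `S(b^∞) = a^∞`.
-/

/-! ### Words of configurations and images under substitutions -/

section Words

variable {A : Type*}

theorem length_wordAt (ξ : ℤ → A) (l : ℤ) (n : ℕ) : (wordAt ξ l n).length = n := by
  simp [wordAt, FreeMonoid.length]

theorem getElem_toList_wordAt (ξ : ℤ → A) (l : ℤ) (n i : ℕ)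
    (hi : i < (wordAt ξ l n).toList.length) :
    (wordAt ξ l n).toList[i] = ξ (l + i) := by
  simp [wordAt]

theorem wordAt_add (ξ : ℤ → A) (l : ℤ) (m n : ℕ) :
    wordAt ξ l (m + n) = wordAt ξ l m * wordAt ξ (l + m) n := by
  apply FreeMonoid.toList.injective
  simp [wordAt, List.range_add, add_assoc]

theorem wordAt_eq_wordAt_iff {ξ η : ℤ → A} {l l' : ℤ} {n : ℕ} :
    wordAt ξ l n = wordAt η l' n ↔ ∀ i < n, ξ (l + i) = η (l' + i) := by
  constructor
  · intro h i hi
    have := congrArg (fun w => w.toList[i]?) h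
    simpa [wordAt, hi] using this
  · intro h
    apply FreeMonoid.toList.injective
    apply List.ext_getElem
    · simp [wordAt]
    · intro i h1 _
      simpa [wordAt] using h i (by simpa [wordAt] using h1)

theorem wordAt_infix (ξ : ℤ → A) {l l' : ℤ} {n n' : ℕ} (h1 : l' ≤ l) (h2 : l + n ≤ l' + n') :
    (wordAt ξ l n).toList <:+: (wordAt ξ l' n').toList := by
  obtain ⟨p, hp⟩ := Int.eq_ofNat_of_zero_le (sub_nonneg.mpr h1)
  obtain ⟨q, hq⟩ := Int.eq_ofNat_of_zero_le (sub_nonneg.mpr h2)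
  have e : n' = p + n + q := by omega
  have e' : l = l' + p := by omega
  subst e e'
  refine ⟨(wordAt ξ l' p).toList, (wordAt ξ (l' + (p + n : ℕ)) q).toList, ?_⟩
  rw [wordAt_add, wordAt_add]
  rfl

/-- A subword of a word occurring in a configuration occurs there too. -/
theorem exists_wordAt_of_infix {ξ : ℤ → A} {l : ℤ} {n : ℕ} {w : FreeMonoid A}
    (h : w.toList <:+: (wordAt ξ l n).toList) : ∃ l', wordAt ξ l' w.length = w := by
  obtain ⟨u, v, h⟩ := h
  have hlen := congrArg List.length h
  have hn : n = FreeMonoid.length (FreeMonoid.ofList u) + w.length +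
      FreeMonoid.length (FreeMonoid.ofList v) := by
    simpa [wordAt, FreeMonoid.length, add_assoc] using hlen.symm
  rw [hn, wordAt_add, wordAt_add, FreeMonoid.toList_mul, FreeMonoid.toList_mul] at h
  refine ⟨l + (FreeMonoid.ofList u).length, FreeMonoid.toList.injective ?_⟩
  have h1 := List.append_inj h (by
    simp [wordAt, FreeMonoid.length])
  exact (List.append_inj h1.1 (by simp [wordAt, FreeMonoid.length])).2.symm

namespace Substitution

variable {S : Substitution A}

theorem length_le_length_apply (hS : ∀ x, S (FreeMonoid.of x) ≠ 1) (w : FreeMonoid A) :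
    w.length ≤ (S w).length := by
  induction w using FreeMonoid.inductionOn' with
  | one => simp
  | of_mul x w ih =>
    have : (S (FreeMonoid.of x)).length ≠ 0 := fun h => hS x (FreeMonoid.length_eq_zero.mp h)
    simp only [map_mul, FreeMonoid.length_mul, FreeMonoid.length_of]
    omega

theorem length_le_length_iterate (hS : ∀ x, S (FreeMonoid.of x) ≠ 1) (w : FreeMonoid A) (k : ℕ) :
    w.length ≤ (S^[k] w).length := by
  induction k with
  | zero => rfl
  | succ k ih =>
    rw [Function.iterate_succ_apply']
    exact ih.trans (length_le_length_apply hS _)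

theorem map_infix (S : Substitution A) {u w : FreeMonoid A} (h : u.toList <:+: w.toList) :
    (S u).toList <:+: (S w).toList := by
  obtain ⟨p, q, h⟩ := h
  have : w = FreeMonoid.ofList p * u * FreeMonoid.ofList q := FreeMonoid.toList.injective h.symm
  rw [this, map_mul S, map_mul S]
  exact ⟨_, _, rfl⟩

theorem iterate_infix (S : Substitution A) {u w : FreeMonoid A} (h : u.toList <:+: w.toList)
    (k : ℕ) : (S^[k] u).toList <:+: (S^[k] w).toList := by
  induction k with
  | zero => exact h
  | succ k ih =>
    rw [Function.iterate_succ_apply', Function.iterate_succ_apply']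
    exact map_infix S ih

theorem mem_dictionary_iff {w : FreeMonoid A} :
    w ∈ S.dictionary ↔ ∃ n x, w.toList <:+: (S^[n] (FreeMonoid.of x)).toList := by
  constructor
  · rintro ⟨n, x, u, v, h⟩
    exact ⟨n, x, u.toList, v.toList, by rw [h]; rfl⟩
  · rintro ⟨n, x, u, v, h⟩
    exact ⟨n, x, FreeMonoid.ofList u, FreeMonoid.ofList v, FreeMonoid.toList.injective h.symm⟩

/-- The image configuration reads `S(ξ(0) … ξ(N-1))` to the right of the dot. -/
theorem wordAt_onConfig_zero (hS : ∀ x, S (FreeMonoid.of x) ≠ 1) (ξ : ℤ → A) (N : ℕ) :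
    wordAt (S.onConfig ξ) 0 (S (wordAt ξ 0 N)).length = S (wordAt ξ 0 N) := by
  have hpre : ∀ a b, (S (wordAt ξ 0 a)).toList <+: (S (wordAt ξ 0 (a + b))).toList := fun a b => by
    rw [wordAt_add, map_mul]
    exact ⟨_, rfl⟩
  apply FreeMonoid.toList.injective
  apply List.ext_getElem
  · exact length_wordAt _ _ _
  · intro i _ h2
    have h3 : i < (S (wordAt ξ 0 (i + 1))).toList.length := by
      have := length_le_length_apply hS (wordAt ξ 0 (i + 1))
      rw [length_wordAt] at this
      exact this
    rw [getElem_toList_wordAt, zero_add, onConfig, if_pos (Int.natCast_nonneg i), Int.toNat_natCast,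
      List.getD_eq_getElem _ _ h3, (hpre (i + 1) N).getElem h3, (hpre N (i + 1)).getElem h2]
    congr 4
    omega

/-- The image configuration reads `S(ξ(-N) … ξ(-1))` to the left of the dot. -/
theorem wordAt_onConfig_neg (hS : ∀ x, S (FreeMonoid.of x) ≠ 1) (ξ : ℤ → A) (N : ℕ) :
    wordAt (S.onConfig ξ) (-((S (wordAt ξ (-N) N)).length : ℤ)) (S (wordAt ξ (-N) N)).length =
      S (wordAt ξ (-N) N) := by
  have hpre : ∀ a b c : ℕ, c = a + b → (S (wordAt ξ (-a) a)).toList.reverse <+: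
      (S (wordAt ξ (-c) c)).toList.reverse := by
    rintro a b c rfl
    have e : -((a + b : ℕ) : ℤ) + b = -a := by push_cast; ring
    rw [add_comm a b, wordAt_add, map_mul, add_comm b a, e, FreeMonoid.toList_mul,
      List.reverse_append]
    exact ⟨_, rfl⟩
  apply FreeMonoid.toList.injective
  apply List.reverse_injective
  apply List.ext_getElem
  · simp only [List.length_reverse]
    exact length_wordAt _ _ _
  · intro i h1 h2
    have h3 : i < (S (wordAt ξ (-(i + 1 : ℕ)) (i + 1))).toList.reverse.length := by
      have := length_le_length_apply hS (wordAt ξ (-(i + 1 : ℕ)) (i + 1))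
      rw [length_wordAt] at this
      rw [List.length_reverse]
      exact this
    have h4 : i < (S (wordAt ξ (-N) N)).length := by rwa [List.length_reverse] at h2
    have hlen : (wordAt (S.onConfig ξ) (-((S (wordAt ξ (-N) N)).length : ℤ))
        (S (wordAt ξ (-N) N)).length).toList.length = (S (wordAt ξ (-N) N)).length :=
      length_wordAt _ _ _
    rw [List.getElem_reverse, getElem_toList_wordAt, hlen]
    have e : -((S (wordAt ξ (-N) N)).length : ℤ) + ((S (wordAt ξ (-N) N)).length - 1 - i : ℕ)
        = -(i + 1 : ℕ) := by omega
    have e1 : (-(-((i + 1 : ℕ) : ℤ))).toNat = i + 1 := by omega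
    have e2 : (-(-((i + 1 : ℕ) : ℤ)) - 1).toNat = i := by omega
    rw [e, onConfig, if_neg (by omega), e1, e2, List.getD_eq_getElem _ _ h3,
      (hpre (i + 1) N (N + (i + 1)) (by omega)).getElem h3,
      (hpre N (i + 1) (N + (i + 1)) rfl).getElem h2]

/-- If a configuration is the periodic repetition of the word `s`, with a copy of `s` starting at
position `0`, then its image is the periodic repetition of `S s`, aligned in the same way. -/
theorem onConfig_periodic (hS : ∀ x, S (FreeMonoid.of x) ≠ 1) {η : ℤ → A} {s : FreeMonoid A}
    (h : ∀ N : ℕ, wordAt η 0 (N * s.length) = s ^ N ∧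
      wordAt η (-(N * s.length : ℕ)) (N * s.length) = s ^ N) (N : ℕ) :
    wordAt (S.onConfig η) 0 (N * (S s).length) = S s ^ N ∧
      wordAt (S.onConfig η) (-(N * (S s).length : ℕ)) (N * (S s).length) = S s ^ N := by
  have hlen : (S (s ^ N)).length = N * (S s).length := by
    rw [map_pow]
    induction N with
    | zero => simp
    | succ N ih => rw [pow_succ, FreeMonoid.length_mul, ih, Nat.succ_mul]
  have h1 := wordAt_onConfig_zero hS η (N * s.length)
  have h2 := wordAt_onConfig_neg hS η (N * s.length)
  rw [(h N).1, hlen, map_pow] at h1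
  rw [(h N).2, hlen, map_pow] at h2
  exact ⟨h1, h2⟩

end Substitution

/-- A word of length at least `2 * B` which is cut out of a concatenation of words of length at
most `B` contains one of these words entirely; so it contains every word `w` common to them. -/
theorem List.infix_of_infix_flatten {B : ℕ} {w : List A} {c : List (List A)}
    (hB : ∀ s ∈ c, s.length ≤ B) (hw : ∀ s ∈ c, w <:+: s) {z : List A} (hz : z <:+: c.flatten)
    (hlen : 2 * B ≤ z.length) (hne : z ≠ []) : w <:+: z := by
  obtain ⟨l, r, h⟩ := hz
  induction c generalizing l with
  | nil =>
    simp at h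
    exact absurd h.2.1 hne
  | cons s c ih =>
    have hpos := List.length_pos_iff.mpr hne
    have hs := hB s (by simp)
    rw [List.flatten_cons] at h
    by_cases hl : s.length ≤ l.length
    · have hp : s <+: l :=
        List.prefix_of_prefix_length_le ⟨_, h.symm⟩ ⟨z ++ r, by simp⟩ hl
      obtain ⟨l', rfl⟩ := hp
      refine ih (fun t ht => hB t (by simp [ht])) (fun t ht => hw t (by simp [ht])) l' ?_
      simpa using h
    · cases c with
      | nil =>
        have := congrArg List.length h
        simp at this
        omega
      | cons t c =>
        have ht := hB t (by simp)
        -- the cut starts inside `s`, hence the next word `t` ends before the cut does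
        have hp : l <+: s := List.prefix_of_prefix_length_le ⟨z ++ r, by rw [← h, List.append_assoc]⟩
          ⟨_, rfl⟩ (by omega)
        obtain ⟨s', rfl⟩ := hp
        have h' : z ++ r = s' ++ (t ++ c.flatten) := by simpa using h
        simp only [List.length_append] at hs hl
        have hp2 : s' ++ t <+: z :=
          List.prefix_of_prefix_length_le ⟨c.flatten, by simp [h']⟩ ⟨r, rfl⟩
            (by simp only [List.length_append]; omega)
        exact ((hw t (by simp)).trans ⟨s', [], by simp⟩).trans hp2.isInfix

/-- A subword of a power of `s` which is not longer than `s` is a subword of `s ++ s`. -/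
theorem List.infix_append_self_of_infix_replicate {s z : List A} {M : ℕ}
    (hz : z <:+: (List.replicate M s).flatten) (hlen : z.length ≤ s.length) : z <:+: s ++ s := by
  obtain ⟨l, r, h⟩ := hz
  induction M generalizing l with
  | zero =>
    simp at h
    rw [h.2.1]
    exact List.nil_infix
  | succ M ih =>
    rw [List.replicate_succ, List.flatten_cons] at h
    by_cases hl : s.length ≤ l.length
    · obtain ⟨l', rfl⟩ := List.prefix_of_prefix_length_le ⟨_, h.symm⟩ ⟨z ++ r, by simp⟩ hl
      exact ih l' (by simpa using h)
    · have hp : l ++ z <+: s ++ s := by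
        cases M with
        | zero => exact ⟨r ++ s, by rw [← List.append_assoc, h]; simp⟩
        | succ M =>
          rw [List.replicate_succ, List.flatten_cons] at h
          exact List.prefix_of_prefix_length_le ⟨r, h⟩ ⟨_, List.append_assoc _ _ _⟩
            (by simp only [List.length_append]; omega)
      exact List.IsInfix.trans ⟨l, [], by simp⟩ hp.isInfix

end Words

/-! ### Fibonacci words -/

section Fibonacci

open FibLetter FreeMonoid

theorem fibSubst_a : fibSubst (of a) = of a * of b := rfl

theorem fibSubst_b : fibSubst (of b) = of a := rfl

theorem fibSubst_of_ne_one (x : FibLetter) : fibSubst (of x) ≠ 1 := by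
  cases x
  · rw [fibSubst_a]; exact fun h => by simpa using congrArg FreeMonoid.length h
  · rw [fibSubst_b]; exact of_ne_one a

theorem fibSubst_iterate_b (k : ℕ) : fibSubst^[k + 1] (of b) = fibSubst^[k] (of a) := by
  rw [Function.iterate_succ_apply, fibSubst_b]

theorem fibSubst_iterate_a (k : ℕ) :
    fibSubst^[k + 1] (of a) = fibSubst^[k] (of a) * fibSubst^[k] (of b) := by
  rw [Function.iterate_succ_apply, fibSubst_a, iterate_map_mul]

theorem lt_length_fibSubst_iterate_a (k : ℕ) : k < (fibSubst^[k] (of a)).length := by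
  induction k with
  | zero => simp
  | succ k ih =>
    have := Substitution.length_le_length_iterate fibSubst_of_ne_one (of b) k
    rw [fibSubst_iterate_a, length_mul]
    simp at this
    omega

/-- Both letters occur in `S^k(a)` for `k ≥ 1`, as this word starts with `ab`. -/
theorem of_infix_fibSubst_iterate_a (x : FibLetter) {k : ℕ} (hk : 1 ≤ k) :
    (of x).toList <:+: (fibSubst^[k] (of a)).toList := by
  have key : ∀ k, ∃ r, fibSubst^[k + 1] (of a) = of a * of b * r := by
    intro k
    induction k with
    | zero => exact ⟨1, rfl⟩
    | succ k ih =>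
      obtain ⟨r, hr⟩ := ih
      rw [Function.iterate_succ_apply', hr, map_mul, map_mul, fibSubst_a, fibSubst_b]
      exact ⟨of a * fibSubst r, by simp only [mul_assoc]⟩
  obtain ⟨k, rfl⟩ := Nat.exists_eq_add_of_le' hk
  obtain ⟨r, hr⟩ := key k
  rw [hr]
  cases x
  · exact ⟨[], b :: r.toList, rfl⟩
  · exact ⟨[a], r.toList, rfl⟩

/-- A word of the Fibonacci dictionary is a subword of `S^k(a)` for all large `k`. -/
theorem exists_forall_infix_iterate {w : FreeMonoid FibLetter} (hw : w ∈ fibSubst.dictionary) :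
    ∃ n, ∀ k ≥ n, w.toList <:+: (fibSubst^[k] (of a)).toList := by
  obtain ⟨n, x, h⟩ := Substitution.mem_dictionary_iff.mp hw
  refine ⟨n + 1, fun k hk => h.trans ?_⟩
  obtain ⟨j, rfl⟩ := Nat.exists_eq_add_of_le hk
  rw [add_assoc, Function.iterate_add_apply]
  exact Substitution.iterate_infix _ (of_infix_fibSubst_iterate_a x (by omega)) n

theorem toList_iterate_eq_flatten {A : Type*} (S : Substitution A) (n : ℕ) (c : FreeMonoid A) :
    (S^[n] c).toList = (c.toList.map fun x => (S^[n] (of x)).toList).flatten := by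
  induction c using FreeMonoid.inductionOn' with
  | one => rw [iterate_map_one]; rfl
  | of_mul x c ih => rw [iterate_map_mul, toList_mul, ih]; simp

/-- Every word of the Fibonacci dictionary is a subword of all sufficiently long words of the
dictionary. -/
theorem exists_forall_infix_of_mem_dictionary {w : FreeMonoid FibLetter}
    (hw : w ∈ fibSubst.dictionary) :
    ∃ N, ∀ z ∈ fibSubst.dictionary, N ≤ z.length → w.toList <:+: z.toList := by
  obtain ⟨n, hn⟩ := exists_forall_infix_iterate hw
  -- `w` is contained in both words `S^(n+1)(a)` and `S^(n+1)(b)`, of length at most `B`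
  obtain ⟨B, hB⟩ : ∃ B, ∀ p ≤ n + 1, ∀ x, (fibSubst^[p] (of x)).length ≤ B := by
    refine ⟨∑ p ∈ Finset.range (n + 2), ∑ x, (fibSubst^[p] (of x)).length, fun p hp x => ?_⟩
    calc (fibSubst^[p] (of x)).length ≤ ∑ x, (fibSubst^[p] (of x)).length :=
          Finset.single_le_sum (f := fun x => (fibSubst^[p] (of x)).length)
            (fun _ _ => Nat.zero_le _) (Finset.mem_univ x)
      _ ≤ _ := Finset.single_le_sum (f := fun p => ∑ x, (fibSubst^[p] (of x)).length)
            (fun _ _ => Nat.zero_le _) (Finset.mem_range.mpr (by omega))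
  refine ⟨2 * B + 1, fun z hz hlen => ?_⟩
  obtain ⟨p, y, hp⟩ := Substitution.mem_dictionary_iff.mp hz
  have hlen' : 2 * B + 1 ≤ z.toList.length := hlen
  by_cases hpn : p ≤ n + 1
  · have h1 := hp.length_le
    have h2 : (fibSubst^[p] (of y)).toList.length ≤ B := hB p hpn y
    omega
  · obtain ⟨j, rfl⟩ := Nat.exists_eq_add_of_le (not_le.mp hpn).le
    rw [Function.iterate_add_apply, toList_iterate_eq_flatten] at hp
    refine List.infix_of_infix_flatten (B := B) ?_ ?_ hp (by omega)
      (List.length_pos_iff.mp (by omega))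
    · intro s hs
      obtain ⟨x, -, rfl⟩ := List.mem_map.mp hs
      exact hB _ le_rfl x
    · intro s hs
      obtain ⟨x, -, rfl⟩ := List.mem_map.mp hs
      cases x
      · exact hn _ (by omega)
      · rw [fibSubst_iterate_b]
        exact hn n le_rfl

theorem fibPeriodic_a_periodic (k N : ℕ) :
    wordAt (fibPeriodic a k) 0 (N * (fibSubst^[k] (of a)).length) = fibSubst^[k] (of a) ^ N ∧
      wordAt (fibPeriodic a k) (-(N * (fibSubst^[k] (of a)).length : ℕ))
        (N * (fibSubst^[k] (of a)).length) = fibSubst^[k] (of a) ^ N := by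
  induction k generalizing N with
  | zero =>
    have key : ∀ l, wordAt (fun _ : ℤ => a) l N = of a ^ N := by
      intro l
      induction N generalizing l with
      | zero => rfl
      | succ N ih => rw [wordAt_add, ih, pow_succ]; rfl
    simp only [fibPeriodic, Function.iterate_zero, id_eq, length_of, mul_one]
    exact ⟨key _, key _⟩
  | succ k ih =>
    simp only [fibPeriodic, Function.iterate_succ_apply'] at ih ⊢
    exact Substitution.onConfig_periodic fibSubst_of_ne_one ih N

theorem toList_pow {A : Type*} (s : FreeMonoid A) (M : ℕ) :
    (s ^ M).toList = (List.replicate M s.toList).flatten := by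
  induction M with
  | zero => rfl
  | succ M ih => rw [pow_succ', toList_mul, ih, List.replicate_succ, List.flatten_cons]

/-- The squares `S^k(a) S^k(a)` are in the dictionary, because `aa` is. -/
theorem mul_self_mem_dictionary (k : ℕ) :
    fibSubst^[k] (of a) * fibSubst^[k] (of a) ∈ fibSubst.dictionary := by
  refine Substitution.mem_dictionary_iff.mpr ⟨k + 3, a, ?_⟩
  rw [← iterate_map_mul, Function.iterate_add_apply]
  refine Substitution.iterate_infix _ ?_ k
  exact ⟨[a, b], [b], rfl⟩

theorem wordAt_fibPeriodic_a_mem_dictionary {k m : ℕ} (hm : m ≤ k) (l : ℤ) :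
    wordAt (fibPeriodic a k) l m ∈ fibSubst.dictionary := by
  set s := fibSubst^[k] (of a) with hs
  have hk : k < s.length := lt_length_fibSubst_iterate_a k
  set N := l.natAbs + m with hN
  have hNs : N ≤ N * s.length := Nat.le_mul_of_pos_right _ (by omega)
  have hword : wordAt (fibPeriodic a k) (-(N * s.length : ℕ)) (N * s.length + N * s.length) =
      s ^ (N + N) := by
    have h := fibPeriodic_a_periodic k N
    rw [← hs] at h
    rw [wordAt_add, neg_add_cancel, h.1, h.2, ← pow_add]
  have h1 : (wordAt (fibPeriodic a k) l m).toList <:+: (s ^ (N + N)).toList := by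
    rw [← hword]
    exact wordAt_infix _ (by omega) (by omega)
  rw [toList_pow] at h1
  have h2 := List.infix_append_self_of_infix_replicate h1 (by
    change (wordAt _ _ _).length ≤ s.length
    rw [length_wordAt]
    omega)
  obtain ⟨n, x, h3⟩ := Substitution.mem_dictionary_iff.mp (mul_self_mem_dictionary k)
  exact Substitution.mem_dictionary_iff.mpr ⟨n, x, h2.trans h3⟩

/-- For each length `m`, the configuration `S^k(a^∞)` and an element of the Fibonacci subshift have
the same words of length `m`, provided `k` is large. -/
theorem eventually_words_fibPeriodic_a {ξ : ℤ → FibLetter} (hξ : ξ ∈ fibSubst.subshift.carrier)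
    (m : ℕ) : ∀ᶠ k in atTop,
      (∀ l, ∃ l', wordAt (fibPeriodic a k) l m = wordAt ξ l' m) ∧
      ∀ l, ∃ l', wordAt ξ l m = wordAt (fibPeriodic a k) l' m := by
  have hξ' : ∀ l n, wordAt ξ l n ∈ fibSubst.dictionary := hξ
  have hfin : {w : FreeMonoid FibLetter | w.length = m}.Finite := List.finite_length_eq FibLetter m
  have h2 : ∀ᶠ k in atTop, ∀ w ∈ {w : FreeMonoid FibLetter | w.length = m},
      w ∈ fibSubst.dictionary → w.toList <:+: (fibSubst^[k] (of a)).toList := by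
    rw [Filter.eventually_all_finite hfin]
    intro w _
    by_cases hw : w ∈ fibSubst.dictionary
    · obtain ⟨n, hn⟩ := exists_forall_infix_iterate hw
      filter_upwards [eventually_ge_atTop n] with k hk _ using hn k hk
    · exact Filter.Eventually.of_forall fun k h => absurd h hw
  filter_upwards [h2, eventually_ge_atTop m] with k hk hmk
  constructor
  · intro l
    obtain ⟨N, hN⟩ :=
      exists_forall_infix_of_mem_dictionary (wordAt_fibPeriodic_a_mem_dictionary hmk l)
    have h := hN (wordAt ξ 0 N) (hξ' _ _) (length_wordAt _ _ _).ge
    obtain ⟨l', hl'⟩ := exists_wordAt_of_infix h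
    rw [length_wordAt] at hl'
    exact ⟨l', hl'.symm⟩
  · intro l
    have h := hk (wordAt ξ l m) (length_wordAt _ _ _) (hξ' _ _)
    have h1 := (fibPeriodic_a_periodic k 1).1
    rw [pow_one, one_mul] at h1
    rw [← h1] at h
    obtain ⟨l', hl'⟩ := exists_wordAt_of_infix h
    rw [length_wordAt] at hl'
    exact ⟨l', hl'.symm⟩

theorem fibPeriodic_b_succ (k : ℕ) : fibPeriodic b (k + 1) = fibPeriodic a k := by
  have key : fibSubst.onConfig (fun _ => b) = fun _ => a := by
    funext m
    have hword : ∀ (n : ℕ) (l : ℤ),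
        fibSubst (wordAt (fun _ => b) l n) = wordAt (fun _ => a) l n := by
      intro n
      induction n with
      | zero => intro l; rfl
      | succ n ih => intro l; rw [wordAt_add, wordAt_add, map_mul, ih]; rfl
    rw [Substitution.onConfig]
    split_ifs with h
    · rw [hword, List.getD_eq_getElem _ _ (by simp [wordAt]), getElem_toList_wordAt]
    · rw [hword, List.getD_eq_getElem _ _ (by simp [wordAt]; omega), List.getElem_reverse,
        getElem_toList_wordAt]
  simp only [fibPeriodic, Function.iterate_succ_apply, key]

end Fibonacci

/-! ### Cutting off square-summable sequences -/

section Cutoff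

theorem EllTwo.add_apply (x y : EllTwo) (n : ℤ) : (x + y) n = x n + y n := rfl

theorem EllTwo.sub_apply (x y : EllTwo) (n : ℤ) : (x - y) n = x n - y n := rfl

theorem EllTwo.smul_apply (z : ℂ) (x : EllTwo) (n : ℤ) : (z • x) n = z * x n := rfl

theorem EllTwo.sum_apply {ι : Type*} (s : Finset ι) (x : ι → EllTwo) (n : ℤ) :
    (∑ i ∈ s, x i) n = ∑ i ∈ s, x i n := by
  rw [lp.coeFn_sum, Finset.sum_apply]

theorem EllTwo.ext {x y : EllTwo} (h : ∀ n, x n = y n) : x = y := lp.ext (funext h)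

theorem EllTwo.hasSum_sq (ψ : EllTwo) : HasSum (fun n => ‖ψ n‖ ^ 2) (‖ψ‖ ^ 2) := by
  simpa using lp.hasSum_norm (p := 2) (by norm_num) ψ

theorem EllTwo.norm_le_mul_norm {x y : EllTwo} {c : ℝ} (hc : 0 ≤ c)
    (h : ∀ n, ‖x n‖ ≤ c * ‖y n‖) : ‖x‖ ≤ c * ‖y‖ := by
  have h2 : ‖x‖ ^ 2 ≤ c ^ 2 * ‖y‖ ^ 2 :=
    hasSum_le (fun n => by
      rw [← mul_pow]
      exact pow_le_pow_left₀ (norm_nonneg _) (h n) 2) x.hasSum_sq (y.hasSum_sq.mul_left _)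
  rw [← mul_pow] at h2
  exact le_of_sq_le_sq h2 (by positivity)

theorem norm_translationOp_apply (m : ℤ) (ψ : EllTwo) : ‖translationOp m ψ‖ = ‖ψ‖ := by
  have h := (translationOp m ψ).hasSum_sq.unique
    ((Equiv.subRight m).hasSum_iff.mpr ψ.hasSum_sq)
  exact (pow_left_inj₀ (norm_nonneg _) (norm_nonneg _) two_ne_zero).mp h

theorem norm_multOp_apply_le {A : Type*} [TopologicalSpace A] [Finite A] (g : C(ℤ → A, ℂ))
    (ξ : ℤ → A) (ψ : EllTwo) : ‖multOp g ξ ψ‖ ≤ ‖g‖ * ‖ψ‖ :=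
  EllTwo.norm_le_mul_norm (norm_nonneg g) fun n => by
    rw [multOp_apply, norm_mul]
    exact mul_le_mul_of_nonneg_right (g.norm_coe_le_norm _) (norm_nonneg _)

/-- The sequence `ψ` multiplied by the finitely supported function `φ` moved to the position `j`:
`n ↦ φ(n - j) ψ(n)`. -/
noncomputable def cutoff (φ : ℤ →₀ ℂ) (j : ℤ) (ψ : EllTwo) : EllTwo :=
  ⟨fun n => φ (n - j) * ψ n, memℓp_gen (summable_of_hasFiniteSupport (by
    refine ((φ.support.image fun i => i + j).finite_toSet).subset fun n hn => ?_
    simp only [Finset.coe_image, Set.mem_image, Finset.mem_coe, Finsupp.mem_support_iff]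
    refine ⟨n - j, fun h => hn ?_, by ring⟩
    simp [h]))⟩

@[simp] theorem cutoff_apply (φ : ℤ →₀ ℂ) (j : ℤ) (ψ : EllTwo) (n : ℤ) :
    cutoff φ j ψ n = φ (n - j) * ψ n := rfl

/-- The squared `ℓ²`-norm of a finitely supported function. -/
noncomputable def Finsupp.sqNorm (φ : ℤ →₀ ℂ) : ℝ := ∑ i ∈ φ.support, ‖φ i‖ ^ 2

/-- Averaging over all positions of the cutoff recovers the norm of the sequence. -/
theorem hasSum_norm_cutoff_sq (φ : ℤ →₀ ℂ) (ψ : EllTwo) :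
    HasSum (fun j => ‖cutoff φ j ψ‖ ^ 2) (φ.sqNorm * ‖ψ‖ ^ 2) := by
  have h1 : ∀ j, ‖cutoff φ j ψ‖ ^ 2 = ∑ i ∈ φ.support, ‖φ i‖ ^ 2 * ‖ψ (i + j)‖ ^ 2 := by
    intro j
    refine (cutoff φ j ψ).hasSum_sq.unique ?_
    rw [← (Equiv.addRight j).hasSum_iff]
    have : (fun n => ‖cutoff φ j ψ n‖ ^ 2) ∘ (Equiv.addRight j) =
        fun i => ‖φ i‖ ^ 2 * ‖ψ (i + j)‖ ^ 2 := by
      funext i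
      simp [mul_pow]
    rw [this]
    exact hasSum_sum_of_ne_finset_zero fun i hi => by
      simp [Finsupp.notMem_support_iff.mp hi]
  simp only [h1, Finsupp.sqNorm, Finset.sum_mul]
  refine hasSum_sum fun i _ => HasSum.mul_left _ ?_
  exact (Equiv.addLeft i).hasSum_iff.mpr ψ.hasSum_sq

theorem Finsupp.sqNorm_nonneg (φ : ℤ →₀ ℂ) : 0 ≤ φ.sqNorm :=
  Finset.sum_nonneg fun _ _ => by positivity

/-- The triangle inequality in `ℓ²` for non-negative real sequences which are given together with
their norms. -/
theorem le_add_sum_of_hasSum_sq {ι : Type*} {s : Finset ι} {a b : ℤ → ℝ} {d : ι → ℤ → ℝ}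
    {A B : ℝ} {D : ι → ℝ} (ha : ∀ j, 0 ≤ a j) (hA : HasSum (fun j => a j ^ 2) (A ^ 2))
    (hB : HasSum (fun j => b j ^ 2) (B ^ 2)) (hD : ∀ i ∈ s, HasSum (fun j => d i j ^ 2) (D i ^ 2))
    (hB0 : 0 ≤ B) (hD0 : ∀ i ∈ s, 0 ≤ D i) (h : ∀ j, a j ≤ b j + ∑ i ∈ s, d i j) :
    A ≤ B + ∑ i ∈ s, D i := by
  have lift : ∀ (f : ℤ → ℝ) (F : ℝ), 0 ≤ F → HasSum (fun j => f j ^ 2) (F ^ 2) →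
      ∃ x : lp (fun _ : ℤ => ℝ) 2, (∀ j, x j = f j) ∧ ‖x‖ = F := by
    intro f F hF hf
    have hmem : Memℓp f 2 := memℓp_gen (by simpa using hf.summable)
    refine ⟨⟨f, hmem⟩, fun _ => rfl, ?_⟩
    have h1 := lp.hasSum_norm (p := 2) (by norm_num) (⟨f, hmem⟩ : lp (fun _ : ℤ => ℝ) 2)
    have h2 : HasSum (fun j => f j ^ 2) (‖(⟨f, hmem⟩ : lp (fun _ : ℤ => ℝ) 2)‖ ^ 2) := by
      simpa using h1
    exact (pow_left_inj₀ (norm_nonneg _) hF two_ne_zero).mp (h2.unique hf)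
  obtain ⟨x, hx, hxB⟩ := lift b B hB0 hB
  have : ∀ i, ∃ y : lp (fun _ : ℤ => ℝ) 2, i ∈ s → (∀ j, y j = d i j) ∧ ‖y‖ = D i := by
    intro i
    by_cases hi : i ∈ s
    · obtain ⟨y, hy⟩ := lift (d i) (D i) (hD0 i hi) (hD i hi)
      exact ⟨y, fun _ => hy⟩
    · exact ⟨0, fun h => absurd h hi⟩
  choose y hy using this
  set z := x + ∑ i ∈ s, y i with hz
  have hzj : ∀ j, z j = b j + ∑ i ∈ s, d i j := by
    intro j
    rw [hz, lp.coeFn_add, Pi.add_apply, lp.coeFn_sum, Finset.sum_apply, hx]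
    congr 1
    exact Finset.sum_congr rfl fun i hi => (hy i hi).1 j
  have hzn : HasSum (fun j => z j ^ 2) (‖z‖ ^ 2) := by
    simpa using lp.hasSum_norm (p := 2) (by norm_num) z
  have h1 : A ^ 2 ≤ ‖z‖ ^ 2 := hasSum_le (fun j => by
    rw [hzj]
    exact pow_le_pow_left₀ (ha j) (h j) 2) hA hzn
  calc A ≤ ‖z‖ := le_of_sq_le_sq h1 (norm_nonneg _)
    _ ≤ ‖x‖ + ‖∑ i ∈ s, y i‖ := norm_add_le _ _
    _ ≤ B + ∑ i ∈ s, D i := by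
      rw [hxB]
      gcongr
      refine (norm_sum_le _ _).trans (Finset.sum_le_sum fun i hi => ((hy i hi).2).le)

/-- The indicator function of the interval `[0, L)`. -/
noncomputable def boxFunction (L : ℕ) : ℤ →₀ ℂ :=
  Finsupp.indicator (Finset.Ico 0 (L : ℤ)) fun _ _ => 1

theorem boxFunction_apply (L : ℕ) (i : ℤ) :
    boxFunction L i = if 0 ≤ i ∧ i < L then 1 else 0 := by
  simp [boxFunction, Finsupp.indicator_apply]

theorem sqNorm_boxFunction (L : ℕ) : (boxFunction L).sqNorm = L := by
  have h : (boxFunction L).support = Finset.Ico 0 (L : ℤ) := by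
    ext i
    simp [boxFunction_apply]
  rw [Finsupp.sqNorm, h, Finset.sum_congr rfl (g := fun _ => (1 : ℝ))]
  · simp
  · intro i hi
    rw [boxFunction_apply, if_pos (Finset.mem_Ico.mp hi)]
    simp

/-- The difference `φ - φ(· + k)` of a finitely supported function and its translate. -/
noncomputable def Finsupp.translateDiff (φ : ℤ →₀ ℂ) (k : ℤ) : ℤ →₀ ℂ :=
  φ - φ.equivMapDomain (Equiv.subRight k)

theorem Finsupp.translateDiff_apply (φ : ℤ →₀ ℂ) (k i : ℤ) :
    φ.translateDiff k i = φ i - φ (i + k) := by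
  simp [translateDiff, Finsupp.equivMapDomain_apply]

/-- Translating an interval changes its indicator function only near the two endpoints, so that the
difference is bounded independently of the length of the interval. -/
theorem sqNorm_translateDiff_boxFunction_le (L : ℕ) (k : ℤ) :
    ((boxFunction L).translateDiff k).sqNorm ≤ 4 * |(k : ℝ)| := by
  set χ := (boxFunction L).translateDiff k with hχ
  have hval : ∀ i, ‖χ i‖ ^ 2 ≤ 1 := by
    intro i
    rw [hχ, Finsupp.translateDiff_apply, boxFunction_apply, boxFunction_apply]
    split_ifs <;> simp
  have hsub : χ.support ⊆
      Finset.Ico (-|k|) |k| ∪ Finset.Ico ((L : ℤ) - |k|) (L + |k|) := by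
    intro i hi
    rw [Finsupp.mem_support_iff, hχ, Finsupp.translateDiff_apply, boxFunction_apply,
      boxFunction_apply] at hi
    simp only [Finset.mem_union, Finset.mem_Ico]
    have h1 := neg_abs_le k
    have h2 := le_abs_self k
    by_contra hcon
    apply hi
    have : (0 ≤ i ∧ i < (L : ℤ)) ↔ (0 ≤ i + k ∧ i + k < (L : ℤ)) := by omega
    simp only [this, sub_self]
  have hcard : (χ.support.card : ℤ) ≤ 4 * |k| := by
    have h1 := (Finset.card_le_card hsub).trans (Finset.card_union_le _ _)
    rw [Int.card_Ico, Int.card_Ico] at h1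
    have := abs_nonneg k
    omega
  calc χ.sqNorm ≤ ∑ i ∈ χ.support, (1 : ℝ) := Finset.sum_le_sum fun i _ => hval i
    _ = ((χ.support.card : ℤ) : ℝ) := by simp
    _ ≤ ((4 * |k| : ℤ) : ℝ) := by exact_mod_cast hcard
    _ = 4 * |(k : ℝ)| := by push_cast; rfl

end Cutoff

/-! ### Transfer of lower bounds between configurations with common words -/

section Transfer

/-- A continuous function on the configuration space depends, up to a small error, only on the
letters in a finite window. -/
theorem exists_window {A : Type*} [TopologicalSpace A] [Finite A] (f : C(ℤ → A, ℂ)) {ε : ℝ}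
    (hε : 0 < ε) : ∃ P : ℕ, ∀ ω ω' : ℤ → A, (∀ i : ℤ, |i| ≤ P → ω i = ω' i) →
      ‖f ω - f ω'‖ ≤ ε := by
  by_contra! hcon
  choose ω ω' hω hf using hcon
  -- a limit of the two sequences along an ultrafilter is the same for both
  obtain ⟨x, hx⟩ : ∃ x, Tendsto ω (hyperfilter ℕ : Filter ℕ) (𝓝 x) := by
    obtain ⟨x, -, hx⟩ := isCompact_univ.ultrafilter_le_nhds ((hyperfilter ℕ).map ω) (by simp)
    exact ⟨x, hx⟩
  have hx' : Tendsto ω' (hyperfilter ℕ : Filter ℕ) (𝓝 x) := by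
    rw [tendsto_pi_nhds] at hx ⊢
    intro i
    refine (hx i).congr' ?_
    have : ∀ᶠ P : ℕ in atTop, ω P i = ω' P i := by
      filter_upwards [eventually_ge_atTop i.natAbs] with P hP
      exact hω P i (by rw [Int.abs_eq_natAbs]; omega)
    exact Nat.hyperfilter_le_atTop this
  have h0 : Tendsto (fun P => ‖f (ω P) - f (ω' P)‖) (hyperfilter ℕ : Filter ℕ) (𝓝 0) := by
    have := ((f.continuous.tendsto x).comp hx).sub ((f.continuous.tendsto x).comp hx')
    simpa using this.norm
  exact absurd (ge_of_tendsto h0 (Filter.Eventually.of_forall fun P => (hf P).le)) (not_le.mpr hε)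

namespace FiniteRangeHamiltonian

variable {A : Type*} [TopologicalSpace A] [Finite A] (H : FiniteRangeHamiltonian A)

theorem op_apply_eq_sum (ξ : ℤ → A) (ψ : EllTwo) :
    H.op ξ ψ = ∑ k ∈ H.K, multOp (H.t k) ξ (translationOp k ψ) + multOp H.v ξ ψ := by
  simp [op]

theorem op_shiftConfig (m : ℤ) (ξ : ℤ → A) (ψ : EllTwo) :
    H.op (shiftConfig m ξ) (translationOp m ψ) = translationOp m (H.op ξ ψ) := by
  have e : ∀ n, shiftConfig (-n) (shiftConfig m ξ) = shiftConfig (-(n - m)) ξ := by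
    intro n
    funext i
    simp only [shiftConfig]
    congr 1
    ring
  refine EllTwo.ext fun n => ?_
  rw [translationOp_apply, op_apply, op_apply]
  simp only [translationOp_apply, e]
  congr 1
  refine Finset.sum_congr rfl fun k _ => ?_
  rw [sub_right_comm]

/-- The commutator of the Hamiltonian with a cutoff involves only the differences of the cutoff
function and its translates. -/
theorem op_cutoff (ξ : ℤ → A) (φ : ℤ →₀ ℂ) (j : ℤ) (ψ : EllTwo) :
    H.op ξ (cutoff φ j ψ) = cutoff φ j (H.op ξ ψ) +
      ∑ k ∈ H.K, multOp (H.t k) ξ (translationOp k (cutoff (φ.translateDiff k) j ψ)) := by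
  refine EllTwo.ext fun n => ?_
  rw [EllTwo.add_apply, EllTwo.sum_apply, op_apply, cutoff_apply, cutoff_apply, op_apply]
  simp only [multOp_apply, translationOp_apply, cutoff_apply, Finsupp.translateDiff_apply, mul_add,
    Finset.mul_sum]
  rw [add_right_comm, ← Finset.sum_add_distrib]
  congr 1
  · refine Finset.sum_congr rfl fun k _ => ?_
    rw [show n - k - j + k = n - j by ring]
    ring
  · ring

/-- If two configurations agree near the support of `ψ`, the two Hamiltonians nearly agree
on `ψ`. -/
theorem exists_norm_op_sub_op_le {ε : ℝ} (hε : 0 < ε) : ∃ P : ℕ, ∀ (ξ η : ℤ → A) (j j' : ℤ)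
    (ψ : EllTwo), (∀ n, ψ n ≠ 0 → j ≤ n ∧ n < j') →
      (∀ n, j - P ≤ n → n < j' + P → ξ n = η n) → ‖H.op ξ ψ - H.op η ψ‖ ≤ ε * ‖ψ‖ := by
  set δ := ε / (H.K.card + 1) with hδ
  have hδ0 : 0 < δ := by positivity
  choose Q hQ using fun f : C(ℤ → A, ℂ) => exists_window f hδ0
  set P := Q H.v + ∑ k ∈ H.K, (Q (H.t k) + k.natAbs) with hP
  have hPk : ∀ k ∈ H.K, Q (H.t k) + k.natAbs ≤ P := fun k hk =>
    (Finset.single_le_sum (f := fun k => Q (H.t k) + k.natAbs) (fun _ _ => Nat.zero_le _) hk).trans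
      (Nat.le_add_left _ _)
  refine ⟨P, fun ξ η j j' ψ hψ hξη => ?_⟩
  have key : ∀ (f : C(ℤ → A, ℂ)) (k : ℤ), Q f + k.natAbs ≤ P →
      ‖multOp f ξ (translationOp k ψ) - multOp f η (translationOp k ψ)‖ ≤ δ * ‖ψ‖ := by
    intro f k hk
    rw [← norm_translationOp_apply k ψ]
    refine EllTwo.norm_le_mul_norm hδ0.le fun n => ?_
    rw [lp.coeFn_sub, Pi.sub_apply, multOp_apply, multOp_apply, ← sub_mul, norm_mul,
      translationOp_apply]
    by_cases h0 : ψ (n - k) = 0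
    · simp [h0]
    · refine mul_le_mul_of_nonneg_right (hQ f _ _ fun i hi => ?_) (norm_nonneg _)
      have := hψ _ h0
      have h1 := neg_abs_le i
      have h2 := le_abs_self i
      simp only [shiftConfig]
      exact hξη _ (by omega) (by omega)
  have hv : ‖multOp H.v ξ ψ - multOp H.v η ψ‖ ≤ δ * ‖ψ‖ := by
    have h := key H.v 0 (by simp [hP])
    have : translationOp 0 ψ = ψ := by ext n; simp
    rwa [this] at h
  rw [op_apply_eq_sum, op_apply_eq_sum, add_sub_add_comm, ← Finset.sum_sub_distrib]
  calc _ ≤ ∑ k ∈ H.K, δ * ‖ψ‖ + δ * ‖ψ‖ := by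
        refine (norm_add_le _ _).trans (add_le_add ((norm_sum_le _ _).trans ?_) hv)
        exact Finset.sum_le_sum fun k hk => key _ k (hPk k hk)
    _ = ε * ‖ψ‖ := by
      rw [Finset.sum_const, nsmul_eq_mul, hδ]
      field_simp

/-- If all long words of `η` occur in `ξ`, then lower bounds for `H_ξ - z` are, up to a small
error, lower bounds for `H_η - z`: they hold for cut off sequences, because there `H_η` looks like a
translate of `H_ξ`, and the error made by cutting off is small on average. -/
theorem exists_transfer_lower_bound {ε : ℝ} (hε : 0 < ε) : ∃ m : ℕ, ∀ ξ η : ℤ → A,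
    (∀ l, ∃ l', wordAt η l m = wordAt ξ l' m) → ∀ (z : ℂ) (δ : ℝ),
      (∀ ψ, δ * ‖ψ‖ ≤ ‖H.op ξ ψ - z • ψ‖) → ∀ ψ, (δ - ε) * ‖ψ‖ ≤ ‖H.op η ψ - z • ψ‖ := by
  set C := ∑ k ∈ H.K, ‖H.t k‖ * √(4 * |(k : ℝ)|) with hC
  have hC0 : 0 ≤ C := Finset.sum_nonneg fun _ _ => by positivity
  obtain ⟨P, hP⟩ := H.exists_norm_op_sub_op_le (half_pos hε)
  -- the length `L` of the cutoff is chosen such that `C / √L ≤ ε / 2`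
  obtain ⟨L, hL⟩ := exists_nat_gt ((2 * C / ε) ^ 2)
  have hL0 : (0 : ℝ) < L := (sq_nonneg _).trans_lt hL
  have hCL : C ≤ ε / 2 * √L := by
    have := (Real.lt_sqrt (by positivity)).mpr hL
    rw [div_lt_iff₀ hε] at this
    linarith
  set φ := boxFunction L with hφ
  refine ⟨P + L + P, fun ξ η hword z δ hδ ψ => ?_⟩
  by_cases hneg : δ - ε / 2 ≤ 0
  · exact (mul_nonpos_of_nonpos_of_nonneg (by linarith) (norm_nonneg _)).trans (norm_nonneg _)
  push Not at hneg
  -- the lower bound for cut off sequences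
  have hcut : ∀ j, (δ - ε / 2) * ‖cutoff φ j ψ‖ ≤
      ‖H.op η (cutoff φ j ψ) - z • cutoff φ j ψ‖ := by
    intro j
    set ψj := cutoff φ j ψ
    obtain ⟨l', hl'⟩ := hword (j - P)
    set p := j - P - l' with hp
    have hsupp : ∀ n, ψj n ≠ 0 → j ≤ n ∧ n < j + L := by
      intro n hn
      have : φ (n - j) ≠ 0 := fun h => hn (by simp [ψj, h])
      rw [hφ, boxFunction_apply] at this
      have := of_not_not fun h => this (if_neg h)
      omega
    have hagree : ∀ n, j - P ≤ n → n < j + L + P → η n = shiftConfig p ξ n := by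
      intro n h1 h2
      have := wordAt_eq_wordAt_iff.mp hl' (n - (j - P)).toNat (by omega)
      rw [shiftConfig]
      convert this using 2 <;> omega
    have hclose := hP η (shiftConfig p ξ) j (j + L) ψj hsupp hagree
    have hshift : δ * ‖ψj‖ ≤ ‖H.op (shiftConfig p ξ) ψj - z • ψj‖ := by
      have e : translationOp p (translationOp (-p) ψj) = ψj := by ext n; simp
      have h := hδ (translationOp (-p) ψj)
      rwa [norm_translationOp_apply, ← norm_translationOp_apply p (_ - _), map_sub, map_smul,
        ← op_shiftConfig, e] at h
    have htri : ‖H.op (shiftConfig p ξ) ψj - z • ψj‖ ≤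
        ‖H.op η ψj - z • ψj‖ + ‖H.op η ψj - H.op (shiftConfig p ξ) ψj‖ := by
      rw [← norm_sub_rev (H.op (shiftConfig p ξ) ψj)]
      refine (norm_add_le _ _).trans' (le_of_eq ?_)
      congr 1
      abel
    linarith
  -- the triangle inequality for each position of the cutoff
  have hpos : ∀ j, (δ - ε / 2) * ‖cutoff φ j ψ‖ ≤ ‖cutoff φ j (H.op η ψ - z • ψ)‖ +
      ∑ k ∈ H.K, ‖H.t k‖ * ‖cutoff (φ.translateDiff k) j ψ‖ := by
    intro j
    have e : H.op η (cutoff φ j ψ) - z • cutoff φ j ψ = cutoff φ j (H.op η ψ - z • ψ) +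
        ∑ k ∈ H.K, multOp (H.t k) η (translationOp k (cutoff (φ.translateDiff k) j ψ)) := by
      rw [op_cutoff, add_sub_right_comm]
      congr 1
      refine EllTwo.ext fun n => ?_
      simp only [EllTwo.sub_apply, EllTwo.smul_apply, cutoff_apply]
      ring
    refine (hcut j).trans ?_
    rw [e]
    refine (norm_add_le _ _).trans ?_
    gcongr
    refine (norm_sum_le _ _).trans (Finset.sum_le_sum fun k _ => ?_)
    rw [← norm_translationOp_apply k (cutoff _ j ψ)]
    exact norm_multOp_apply_le _ _ _
  have hsum := le_add_sum_of_hasSum_sq (s := H.K)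
    (A := (δ - ε / 2) * (√L * ‖ψ‖)) (B := √L * ‖H.op η ψ - z • ψ‖)
    (D := fun k => ‖H.t k‖ * (√(φ.translateDiff k).sqNorm * ‖ψ‖))
    (fun j => by positivity)
    (by
      have := (hasSum_norm_cutoff_sq φ ψ).mul_left ((δ - ε / 2) ^ 2)
      simp only [mul_pow, Real.sq_sqrt hL0.le]
      rwa [hφ, sqNorm_boxFunction] at this)
    (by
      have := hasSum_norm_cutoff_sq φ (H.op η ψ - z • ψ)
      rw [mul_pow, Real.sq_sqrt hL0.le]
      rwa [hφ, sqNorm_boxFunction] at this)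
    (fun k _ => by
      have := (hasSum_norm_cutoff_sq (φ.translateDiff k) ψ).mul_left (‖H.t k‖ ^ 2)
      simpa only [mul_pow, Real.sq_sqrt (Finsupp.sqNorm_nonneg _)] using this)
    (by positivity) (fun k _ => by positivity) hpos
  have herr : ∑ k ∈ H.K, ‖H.t k‖ * (√(φ.translateDiff k).sqNorm * ‖ψ‖) ≤ ε / 2 * √L * ‖ψ‖ := by
    refine le_trans ?_ (mul_le_mul_of_nonneg_right hCL (norm_nonneg ψ))
    rw [hC, Finset.sum_mul]
    refine Finset.sum_le_sum fun k _ => ?_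
    rw [mul_assoc]
    gcongr
    exact sqNorm_translateDiff_boxFunction_le L k
  have hfin : √L * ((δ - ε) * ‖ψ‖) ≤ √L * ‖H.op η ψ - z • ψ‖ := by linarith
  exact le_of_mul_le_mul_left hfin (Real.sqrt_pos.mpr hL0)

end FiniteRangeHamiltonian

end Transfer

/-! ### Lower bounds and spectra of self-adjoint operators -/

section Spectrum

variable {E : Type*} [NormedAddCommGroup E] [InnerProductSpace ℂ E] [CompleteSpace E]

/-- A self-adjoint operator which is bounded below is invertible. -/
theorem IsSelfAdjoint.isUnit_of_bounded_below {T : E →L[ℂ] E} (hT : IsSelfAdjoint T) {c : ℝ}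
    (hc : 0 < c) (h : ∀ x, c * ‖x‖ ≤ ‖T x‖) : IsUnit T := by
  rw [ContinuousLinearMap.isUnit_iff_bijective,
    ContinuousLinearMap.bijective_iff_dense_range_and_antilipschitz]
  constructor
  · rw [Submodule.topologicalClosure_eq_top_iff, Submodule.eq_bot_iff]
    intro x hx
    -- the orthogonal complement of the range is the kernel of the adjoint
    have hTx : T x = 0 := by
      have h1 := hx (T (T x)) ⟨T x, rfl⟩
      have h2 := hT.adjoint_eq
      rw [← h2, ContinuousLinearMap.adjoint_inner_left, h2] at h1
      exact inner_self_eq_zero.mp h1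
    have h3 := h x
    rw [hTx, norm_zero] at h3
    exact norm_le_zero_iff.mp (nonpos_of_mul_nonpos_right h3 hc)
  · refine ⟨Real.toNNReal c⁻¹, T.antilipschitz_of_bound fun x => ?_⟩
    rw [Real.coe_toNNReal _ (inv_nonneg.mpr hc.le), inv_mul_eq_div, le_div_iff₀ hc, mul_comm]
    exact h x

/-- A self-adjoint operator is bounded below by the distance of its spectrum to zero. -/
theorem IsSelfAdjoint.bounded_below_of_spectrum {T : E →L[ℂ] E} (hT : IsSelfAdjoint T) {c : ℝ}
    (hc : 0 < c) (h : ∀ x ∈ spectrum ℝ T, c ≤ |x|) (ψ : E) : c * ‖ψ‖ ≤ ‖T ψ‖ := by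
  have h0 : ∀ x ∈ spectrum ℝ T, x ≠ 0 := fun x hx h' => by
    have := h x hx
    rw [h', abs_zero] at this
    linarith
  have hcont : ContinuousOn (fun x : ℝ => x⁻¹) (spectrum ℝ T) := continuousOn_id.inv₀ h0
  have hmul : cfc (fun x : ℝ => x⁻¹) T * T = 1 := by
    nth_rw 2 [← cfc_id' ℝ T]
    rw [← cfc_mul _ _ T hcont, ← cfc_one ℝ T]
    exact cfc_congr fun x hx => inv_mul_cancel₀ (h0 x hx)
  have hnorm : ‖cfc (fun x : ℝ => x⁻¹) T‖ ≤ c⁻¹ := norm_cfc_le (by positivity) fun x hx => by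
    rw [norm_inv, Real.norm_eq_abs]
    exact inv_anti₀ hc (h x hx)
  have h1 : cfc (fun x : ℝ => x⁻¹) T (T ψ) = ψ := congrArg (fun S : E →L[ℂ] E => S ψ) hmul
  have h2 : ‖ψ‖ ≤ c⁻¹ * ‖T ψ‖ := by
    conv_lhs => rw [← h1]
    exact ContinuousLinearMap.le_of_opNorm_le _ hnorm _
  rwa [inv_mul_eq_div, le_div_iff₀ hc, mul_comm] at h2

end Spectrum

namespace FiniteRangeHamiltonian

variable {A : Type*} [TopologicalSpace A] [Finite A] {H : FiniteRangeHamiltonian A}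

theorem mem_spec {hH : H.IsSymmetric} {ξ : ℤ → A} {x : ℝ} :
    x ∈ H.spec hH ξ ↔ (x : ℂ) ∈ spectrum ℂ (H.op ξ) := Iff.rfl

theorem IsSymmetric.isSelfAdjoint_sub (hH : H.IsSymmetric) (ξ : ℤ → A) (x : ℝ) :
    IsSelfAdjoint (H.op ξ - algebraMap ℂ (EllTwo →L[ℂ] EllTwo) x) := by
  refine (hH.isSelfAdjoint ξ).sub ?_
  rw [IsSelfAdjoint, ← algebraMap_star_comm]
  simp

theorem sub_algebraMap_apply (ξ : ℤ → A) (z : ℂ) (ψ : EllTwo) :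
    (H.op ξ - algebraMap ℂ (EllTwo →L[ℂ] EllTwo) z) ψ = H.op ξ ψ - z • ψ := by
  simp [Algebra.algebraMap_eq_smul_one]

theorem notMem_spec_of_lower_bound (hH : H.IsSymmetric) {ξ : ℤ → A} {x c : ℝ} (hc : 0 < c)
    (h : ∀ ψ, c * ‖ψ‖ ≤ ‖H.op ξ ψ - (x : ℂ) • ψ‖) : x ∉ H.spec hH ξ := by
  rw [mem_spec, spectrum.notMem_iff, ← neg_sub, IsUnit.neg_iff]
  exact (hH.isSelfAdjoint_sub ξ x).isUnit_of_bounded_below hc fun ψ => by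
    rw [sub_algebraMap_apply]
    exact h ψ

theorem lower_bound_of_forall_spec (hH : H.IsSymmetric) {ξ : ℤ → A} {x c : ℝ} (hc : 0 < c)
    (h : ∀ y ∈ H.spec hH ξ, c ≤ dist x y) (ψ : EllTwo) :
    c * ‖ψ‖ ≤ ‖H.op ξ ψ - (x : ℂ) • ψ‖ := by
  rw [← sub_algebraMap_apply]
  refine (hH.isSelfAdjoint_sub ξ x).bounded_below_of_spectrum hc (fun y hy => ?_) ψ
  have h1 : ((y + x : ℝ) : ℂ) ∈ spectrum ℂ (H.op ξ) := by
    have := (spectrum.algebraMap_mem_iff ℂ).mpr hy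
    rw [spectrum.mem_iff] at this ⊢
    convert this using 2
    simp
    abel
  have h2 := h _ (mem_spec.mpr h1)
  rwa [dist_comm, Real.dist_eq, add_sub_cancel_right] at h2

/-- If all long words of `η` occur in `ξ`, then the spectrum of `H_η` lies near that of `H_ξ`. -/
theorem exists_spec_near (hH : H.IsSymmetric) {ε : ℝ} (hε : 0 < ε) : ∃ m : ℕ, ∀ ξ η : ℤ → A,
    (∀ l, ∃ l', wordAt η l m = wordAt ξ l' m) →
      ∀ x ∈ H.spec hH η, ∃ y ∈ H.spec hH ξ, dist x y ≤ ε := by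
  obtain ⟨m, hm⟩ := H.exists_transfer_lower_bound (half_pos hε)
  refine ⟨m, fun ξ η hword x hx => ?_⟩
  by_contra! hcon
  refine notMem_spec_of_lower_bound hH (half_pos hε) (fun ψ => ?_) hx
  have := hm ξ η hword x ε (lower_bound_of_forall_spec hH hε fun y hy => (hcon y hy).le) ψ
  rwa [sub_half] at this

/-- Spectra converge in the Hausdorff metric if the words of each length eventually coincide. -/
theorem tendsto_spec_of_eventually_words (hH : H.IsSymmetric) {ξ : ℤ → A} {η : ℕ → ℤ → A}
    (h : ∀ m : ℕ, ∀ᶠ k in atTop, (∀ l, ∃ l', wordAt (η k) l m = wordAt ξ l' m) ∧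
      ∀ l, ∃ l', wordAt ξ l m = wordAt (η k) l' m) :
    Tendsto (fun k => H.spec hH (η k)) atTop (𝓝 (H.spec hH ξ)) := by
  rw [Metric.tendsto_nhds]
  intro ε hε
  obtain ⟨m, hm⟩ := exists_spec_near hH (half_pos hε)
  filter_upwards [h m] with k hk
  rw [Metric.NonemptyCompacts.dist_eq]
  exact (Metric.hausdorffDist_le_of_mem_dist (half_pos hε).le (hm _ _ hk.1) (hm _ _ hk.2)).trans_lt
    (half_lt_self hε)

end FiniteRangeHamiltonian

theorem mainTheorem7 (H : FiniteRangeHamiltonian FibLetter) (hH : H.IsSymmetric)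
    (ξ : ℤ → FibLetter) (hξ : ξ ∈ fibSubst.subshift.carrier) :
    Tendsto (fun k : ℕ => H.spec hH (fibPeriodic FibLetter.a k)) atTop (𝓝 (H.spec hH ξ)) ∧
    Tendsto (fun k : ℕ => H.spec hH (fibPeriodic FibLetter.b k)) atTop (𝓝 (H.spec hH ξ)) := by
  have ha := FiniteRangeHamiltonian.tendsto_spec_of_eventually_words hH
    (eventually_words_fibPeriodic_a hξ)
  refine ⟨ha, (tendsto_add_atTop_iff_nat 1).mp ?_⟩
  simpa only [fibPeriodic_b_succ] using ha
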